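/- Let $\lambda\in(0,1)$. For $s\in\mathbb{C}$ put $$F(\lambda,s)=\int_0^1\Bigl(\frac1u-1\Bigr)^{\lambda}\Bigl(1-\frac{\lambda}{1-u}\Bigr)e^{-us}\,du .$$ 1. For every real $s>0$ the integral $F(\lambda,s)$ converges absolutely and $F(\lambda,s)>0$. 2. Let $x>y>0$ and let $G_{x,y;\lambda}(z)=(x+z)^{\lambda}(y+z)^{1-\lambda}$ with principal branches of the powers. Then $G_{x,y;\lambda}$ is holomorphic on $\mathbb{C}\setminus(-\infty,-y]$, agrees with the real weighted geometric mean at real $z=t>-y$, and has the integral representation $$G_{x,y;\lambda}(z)=x^{\lambda}y^{1-\lambda}+z+\frac{\sin(\lambda\pi)}{\pi}(x-y)\int_0^{\infty}\frac{F(\lambda,(x-y)s)}{s}\,e^{-sy}\bigl(1-e^{-sz}\bigr)\,ds,\qquad z\in\mathbb{C}\setminus(-\infty,-y],$$ in the following sense. If $\operatorname{Re}z\ge-y$, the integral over the positive half-line converges absolutely and the identity holds. In general, for every $z\in\mathbb{C}\setminus(-\infty,-y]$ and every $\omega\in\mathbb{C}$ with $\operatorname{Re}\omega>0$ and $\operatorname{Re}(\omega(y+z))\ge0$,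 the integral taken from $0$ to $\infty$ along the ray $\{\omega r:r>0\}$ converges absolutely and the identity holds with it; for every such $z$ there is an $\omega$ with $\operatorname{Re}\omega>0$ and $\operatorname{Re}(\omega(y+z))>0$. 3. For all $x,y>0$ the function $G_{x,y;\lambda}(t)=(x+t)^{\lambda}(y+t)^{1-\lambda}$ is a Bernstein function of $t\in(-\min\{x,y\},\infty)$; that is, it is nonnegative and infinitely differentiable there, and $(-1)^k\,(G_{x,y;\lambda}')^{(k)}(t)\ge0$ for all integers $k\ge0$ and all $t>-\min\{x,y\}$. -/

import Mathlib

/-- Complete monotonicity on an (open) interval `I`: `f` has derivatives of all orders on `I`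
and `(-1)^k f^{(k)} ≥ 0` on `I` for all `k ≥ 0`. -/
def IsCompletelyMonotonicOn (f : ℝ → ℝ) (I : Set ℝ) : Prop :=
  ContDiffOn ℝ (⊤ : ℕ∞) f I ∧ ∀ k : ℕ, ∀ t ∈ I, 0 ≤ (-1 : ℝ) ^ k * iteratedDeriv k f t

/-- Bernstein function on an (open) interval `I`: nonnegative, with derivatives of all orders,
and with completely monotonic derivative. -/
def IsBernsteinOn (f : ℝ → ℝ) (I : Set ℝ) : Prop :=
  (∀ t ∈ I, 0 ≤ f t) ∧ ContDiffOn ℝ (⊤ : ℕ∞) f I ∧ IsCompletelyMonotonicOn (deriv f) I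

/-- The weighted geometric mean `(x+t)^l (y+t)^(1-l)` of a real variable `t`. -/
noncomputable def weightedGeom (x y l t : ℝ) : ℝ :=
  (x + t) ^ l * (y + t) ^ (1 - l)

/-- The principal branch of `(x+z)^l (y+z)^(1-l)`. -/
noncomputable def weightedGeomC (x y l : ℝ) (z : ℂ) : ℂ :=
  ((x : ℂ) + z) ^ (l : ℂ) * ((y : ℂ) + z) ^ ((1 - l : ℝ) : ℂ)

/-- The slit plane `ℂ ∖ (-∞, -y]`. -/
def slitAt (y : ℝ) : Set ℂ :=
  (Complex.ofReal '' Set.Iic (-y))ᶜ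

/-- The weight `(1/u - 1)^l (1 - l/(1-u))`, for `0 < u < 1`. -/
noncomputable def kernelWeight (l u : ℝ) : ℝ :=
  (1 / u - 1) ^ l * (1 - l / (1 - u))

/-- `F(l,s) = ∫_0^1 (1/u - 1)^l (1 - l/(1-u)) e^{-us} du` for real `s`. -/
noncomputable def kernelF (l s : ℝ) : ℝ :=
  ∫ u in Set.Ioo (0 : ℝ) 1, kernelWeight l u * Real.exp (-(u * s))

/-- The same integral `F(l,s)` for complex `s`. -/
noncomputable def kernelFC (l : ℝ) (s : ℂ) : ℂ :=
  ∫ u in Set.Ioo (0 : ℝ) 1, (kernelWeight l u : ℂ) * Complex.exp (-((u : ℂ) * s))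

/-- The integrand `F(l,(x-y)s)/s · e^{-sy} (1 - e^{-sz})` on the positive half-line. -/
noncomputable def meanIntegrand (x y l : ℝ) (z : ℂ) (s : ℝ) : ℂ :=
  ((kernelF l ((x - y) * s) / s * Real.exp (-(s * y)) : ℝ) : ℂ) *
    (1 - Complex.exp (-((s : ℂ) * z)))

/-- The integrand `F(l,(x-y)s)/s · e^{-sy} (1 - e^{-sz})` for complex `s`. -/
noncomputable def meanIntegrandC (x y l : ℝ) (z s : ℂ) : ℂ :=
  kernelFC l (((x - y : ℝ) : ℂ) * s) / s * Complex.exp (-(s * (y : ℂ))) *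
    (1 - Complex.exp (-(s * z)))

/-- The pull-back `r ↦ f(ωr) ω` of `f(s) ds` to the ray `{ωr : r > 0}`, so that
`∫_{ray} f(s) ds = ∫_0^∞ f(ωr) ω dr`. -/
def alongRay (f : ℂ → ℂ) (ω : ℂ) (r : ℝ) : ℂ :=
  f (ω * (r : ℂ)) * ω

/-! Write `k(u) = u^(1-l) (1-u)^l`, `d = x - y` and `S(w) = ∫_0^1 k(u)/(u+w) du`. Everything rests
on the Stieltjes representation `(1+w)^l w^(1-l) = w + l - (sin(lπ)/π) S(w)` on the slit plane
(`cpow_mul_cpow_eq_stieltjes`). For real `w > 1` both sides expand in powers of `1/w`: the left by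
the binomial series, `S` by a geometric series whose coefficients are moments of `k`. These moments
are Beta values, and the reflection formula turns them into binomial coefficients. The identity
theorem then extends the equality to the slit plane.

The weight in `F` is `k'`, and `k` vanishes at both ends, so `F(l,s) = s ∫_0^1 k(u) e^{-us} du`.
This gives positivity and cancels the `1/s` in the representation. Fubini along a ray turns the
integral there into `S(y/d) - S((y+z)/d)`. Putting `w = (y+z)/d` in the Stieltjes formula, scaling
by `d` and comparing with `z = 0` yields the claim.

The Bernstein property comes from the same formula for `x > y`: the derivatives of `-S` alternate in
sign on `(0,∞)`, because `k > 0`. Exchanging `x` and `y` replaces `l` by `1 - l`, and `x = y` is the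
affine case. -/

open MeasureTheory Set Filter Topology

/-- The primitive `u^(1-l) (1-u)^l` of `kernelWeight l`, vanishing at `0` and at `1`. -/
noncomputable def kernelPrimitive (l u : ℝ) : ℝ :=
  u ^ (1 - l) * (1 - u) ^ l

/-! ### Real Beta integrals on the open unit interval. -/

section Beta

theorem betaIntegrand_ofReal (a b : ℝ) {u : ℝ} (hu : u ∈ Ioo (0 : ℝ) 1) :
    ((u ^ (a - 1) * (1 - u) ^ (b - 1) : ℝ) : ℂ) =
      (u : ℂ) ^ ((a : ℂ) - 1) * (1 - (u : ℂ)) ^ ((b : ℂ) - 1) := by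
  have h : (0 : ℝ) ≤ 1 - u := by linarith [hu.2]
  rw [Complex.ofReal_mul, Complex.ofReal_cpow hu.1.le, Complex.ofReal_cpow h]
  push_cast
  rfl

theorem integrableOn_beta {a b : ℝ} (ha : 0 < a) (hb : 0 < b) :
    IntegrableOn (fun u : ℝ => u ^ (a - 1) * (1 - u) ^ (b - 1)) (Ioo 0 1) := by
  have h := Complex.betaIntegral_convergent (u := a) (v := b) (by simpa) (by simpa)
  rw [intervalIntegrable_iff_integrableOn_Ioo_of_le zero_le_one] at h
  refine (IntegrableOn.congr_fun h.re (fun u hu => ?_) measurableSet_Ioo)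
  rw [← betaIntegrand_ofReal a b hu]
  simp

theorem integral_beta {a b : ℝ} (ha : 0 < a) (hb : 0 < b) :
    ∫ u in Ioo (0 : ℝ) 1, u ^ (a - 1) * (1 - u) ^ (b - 1) =
      Real.Gamma a * Real.Gamma b / Real.Gamma (a + b) := by
  have h := Complex.betaIntegral_eq_Gamma_mul_div a b (by simpa) (by simpa)
  rw [Complex.betaIntegral, intervalIntegral.integral_of_le zero_le_one, integral_Ioc_eq_integral_Ioo,
    ← setIntegral_congr_fun measurableSet_Ioo (fun u hu => betaIntegrand_ofReal a b hu),
    integral_complex_ofReal, ← Complex.ofReal_add, Complex.Gamma_ofReal, Complex.Gamma_ofReal,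
    Complex.Gamma_ofReal] at h
  exact_mod_cast h

end Beta

/-! ### The kernel, its primitive, and positivity of `F`. -/

section Primitive

variable {l : ℝ}

theorem continuous_kernelPrimitive (hl0 : 0 < l) (hl1 : l < 1) :
    Continuous (kernelPrimitive l) := by
  unfold kernelPrimitive
  exact (Real.continuous_rpow_const (by linarith)).mul
    ((Real.continuous_rpow_const hl0.le).comp (by fun_prop))

theorem kernelPrimitive_pos {u : ℝ} (hu : u ∈ Ioo (0 : ℝ) 1) : 0 < kernelPrimitive l u :=
  mul_pos (Real.rpow_pos_of_pos hu.1 _) (Real.rpow_pos_of_pos (by linarith [hu.2]) _)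

theorem kernelPrimitive_le_one (hl0 : 0 < l) (hl1 : l < 1) {u : ℝ} (hu : u ∈ Ioo (0 : ℝ) 1) :
    kernelPrimitive l u ≤ 1 :=
  mul_le_one₀ (Real.rpow_le_one hu.1.le hu.2.le (by linarith))
    (Real.rpow_nonneg (by linarith [hu.2]) _)
    (Real.rpow_le_one (by linarith [hu.2]) (by linarith [hu.1]) hl0.le)

theorem norm_kernelPrimitive_le_one (hl0 : 0 < l) (hl1 : l < 1) {u : ℝ}
    (hu : u ∈ Ioo (0 : ℝ) 1) : ‖(kernelPrimitive l u : ℂ)‖ ≤ 1 := by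
  rw [Complex.norm_real, Real.norm_of_nonneg (kernelPrimitive_pos hu).le]
  exact kernelPrimitive_le_one hl0 hl1 hu

theorem kernelWeight_eq {u : ℝ} (hu : u ∈ Ioo (0 : ℝ) 1) :
    kernelWeight l u = u ^ (-l) * (1 - u) ^ l - l * (u ^ (-l) * (1 - u) ^ (l - 1)) := by
  have h0 := hu.1
  have h1 : (0 : ℝ) < 1 - u := by linarith [hu.2]
  have e : 1 / u - 1 = (1 - u) / u := by field_simp
  rw [kernelWeight, e, Real.div_rpow h1.le h0.le, Real.rpow_neg h0.le, Real.rpow_sub_one h1.ne']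
  field_simp

theorem hasDerivAt_kernelPrimitive {u : ℝ} (hu : u ∈ Ioo (0 : ℝ) 1) :
    HasDerivAt (kernelPrimitive l) (kernelWeight l u) u := by
  have h0 := hu.1
  have h1 : (0 : ℝ) < 1 - u := by linarith [hu.2]
  have d1 := (hasDerivAt_id u).rpow_const (p := 1 - l) (Or.inl h0.ne')
  have d2 := ((hasDerivAt_id u).const_sub 1).rpow_const (p := l) (Or.inl h1.ne')
  refine (d1.mul d2).congr_deriv ?_
  rw [kernelWeight_eq hu]
  have e1 : (1 : ℝ) - l - 1 = -l := by ring
  have e2 : u ^ (1 - l) = u * u ^ (-l) := by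
    rw [show (1 : ℝ) - l = -l + 1 by ring, Real.rpow_add_one h0.ne']; ring
  have e3 : (1 - u) ^ l = (1 - u) * (1 - u) ^ (l - 1) := by
    rw [Real.rpow_sub_one h1.ne']; field_simp
  simp only [id, e1, e2, e3]
  ring

theorem integrableOn_kernelWeight (hl0 : 0 < l) (hl1 : l < 1) :
    IntegrableOn (kernelWeight l) (Ioo 0 1) := by
  have h1 := integrableOn_beta (a := 1 - l) (b := l + 1) (by linarith) (by linarith)
  have h2 := integrableOn_beta (a := 1 - l) (b := l) (by linarith) hl0
  refine IntegrableOn.congr_fun (h1.sub (h2.const_mul l)) (fun u hu => ?_) measurableSet_Ioo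
  simp only [kernelWeight_eq hu, Pi.sub_apply]
  simp

theorem integrableOn_kernelWeight_mul_exp (hl0 : 0 < l) (hl1 : l < 1) (s : ℂ) :
    IntegrableOn (fun u : ℝ => (kernelWeight l u : ℂ) * Complex.exp (-((u : ℂ) * s)))
      (Ioo 0 1) := by
  have h : IntegrableOn (fun u => (kernelWeight l u : ℂ)) (Icc 0 1) :=
    (integrableOn_Icc_iff_integrableOn_Ioo (by simp) (by simp)).2
      (integrableOn_kernelWeight hl0 hl1).ofReal
  have hc : Continuous fun u : ℝ => Complex.exp (-((u : ℂ) * s)) := by fun_prop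
  exact (h.mul_continuousOn hc.continuousOn isCompact_Icc).mono_set Ioo_subset_Icc_self

theorem integrableOn_kernelWeight_mul_real_exp (hl0 : 0 < l) (hl1 : l < 1) (s : ℝ) :
    IntegrableOn (fun u : ℝ => kernelWeight l u * Real.exp (-(u * s))) (Ioo 0 1) := by
  refine (integrableOn_kernelWeight_mul_exp hl0 hl1 s).re.congr (.of_forall fun u => ?_)
  have : (kernelWeight l u : ℂ) * Complex.exp (-((u : ℂ) * s)) =
      ((kernelWeight l u * Real.exp (-(u * s)) : ℝ) : ℂ) := by push_cast; rfl
  simp only [this]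
  exact Complex.ofReal_re _

theorem kernelFC_ofReal (s : ℝ) : kernelFC l s = (kernelF l s : ℂ) := by
  rw [kernelFC, kernelF, ← integral_complex_ofReal]
  push_cast
  rfl

theorem integrableOn_of_continuous {f : ℝ → ℂ} (hf : Continuous f) :
    IntegrableOn f (Ioo 0 1) :=
  (hf.continuousOn.integrableOn_compact isCompact_Icc).mono_set Ioo_subset_Icc_self

/-- Integration by parts: `F(l,s) = s ∫_0^1 u^(1-l) (1-u)^l e^{-us} du`. -/
theorem kernelFC_eq_mul_integral (hl0 : 0 < l) (hl1 : l < 1) (s : ℂ) :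
    kernelFC l s =
      s * ∫ u in Ioo (0 : ℝ) 1, (kernelPrimitive l u : ℂ) * Complex.exp (-((u : ℂ) * s)) := by
  have hc : Continuous fun u : ℝ =>
      (kernelPrimitive l u : ℂ) * Complex.exp (-((u : ℂ) * s)) := by
    have := continuous_kernelPrimitive hl0 hl1
    fun_prop
  have hi1 := integrableOn_kernelWeight_mul_exp hl0 hl1 s
  have hi2 := (integrableOn_of_continuous hc).const_mul s
  -- The weight can blow up at the endpoints, so this form of the fundamental theorem asks for
  -- differentiability only inside, with continuity up to the boundary and an integrable derivative.
  have key := intervalIntegral.integral_eq_sub_of_hasDerivAt_of_le (zero_le_one (α := ℝ))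
    hc.continuousOn
    (f' := fun u : ℝ => (kernelWeight l u : ℂ) * Complex.exp (-((u : ℂ) * s)) -
      s * ((kernelPrimitive l u : ℂ) * Complex.exp (-((u : ℂ) * s))))
    (fun u hu => by
      have d1 := (hasDerivAt_kernelPrimitive (l := l) hu).ofReal_comp
      have d2 : HasDerivAt (fun u : ℝ => Complex.exp (-((u : ℂ) * s)))
          (Complex.exp (-((u : ℂ) * s)) * -(1 * s)) u :=
        (((hasDerivAt_id u).ofReal_comp.mul_const s).neg).cexp
      refine (d1.mul d2).congr_deriv ?_
      ring)
    ((intervalIntegrable_iff_integrableOn_Ioo_of_le zero_le_one).2 (hi1.sub hi2))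
  rw [intervalIntegral.integral_of_le zero_le_one, integral_Ioc_eq_integral_Ioo,
    integral_sub hi1 hi2, integral_const_mul] at key
  -- Both boundary terms vanish because the exponents `1 - l` and `l` are nonzero.
  have h0 : kernelPrimitive l 0 = 0 := by
    simp [kernelPrimitive, Real.zero_rpow (show 1 - l ≠ 0 by linarith)]
  have h1 : kernelPrimitive l 1 = 0 := by
    simp [kernelPrimitive, Real.zero_rpow hl0.ne']
  rw [h0, h1] at key
  rw [kernelFC]
  simpa [sub_eq_zero] using key

/-- The weight itself changes sign at `u = 1 - l`; after integration by parts the integrand is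
positive. -/
theorem kernelF_pos (hl0 : 0 < l) (hl1 : l < 1) {s : ℝ} (hs : 0 < s) : 0 < kernelF l s := by
  have h := kernelFC_eq_mul_integral hl0 hl1 s
  have e : ∀ u : ℝ, (kernelPrimitive l u : ℂ) * Complex.exp (-((u : ℂ) * s)) =
      ((kernelPrimitive l u * Real.exp (-(u * s)) : ℝ) : ℂ) := fun u => by push_cast; rfl
  simp_rw [kernelFC_ofReal, e, integral_complex_ofReal] at h
  have h' : kernelF l s =
      s * ∫ u in Ioo (0 : ℝ) 1, kernelPrimitive l u * Real.exp (-(u * s)) := by exact_mod_cast h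
  rw [h']
  refine mul_pos hs ?_
  have hc : Continuous fun u : ℝ => kernelPrimitive l u * Real.exp (-(u * s)) := by
    have := continuous_kernelPrimitive hl0 hl1
    fun_prop
  rw [← integral_Ioc_eq_integral_Ioo, ← intervalIntegral.integral_of_le zero_le_one]
  exact intervalIntegral.intervalIntegral_pos_of_pos_on (hc.intervalIntegrable 0 1)
    (fun u hu => mul_pos (kernelPrimitive_pos hu) (Real.exp_pos _)) zero_lt_one

end Primitive

/-- The transform `∫_0^1 u^(1-l) (1-u)^l / (u+w)^(n+1) du`. -/
noncomputable def kernelStieltjes (l : ℝ) (n : ℕ) (w : ℂ) : ℂ :=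
  ∫ u in Ioo (0 : ℝ) 1, (kernelPrimitive l u : ℂ) * (((u : ℂ) + w) ^ (n + 1))⁻¹

/-! ### Derivatives of the Stieltjes transform, and moments of the kernel. -/

section Stieltjes

variable {l : ℝ}

theorem ofReal_add_mem_slitPlane {w : ℂ} (hw : w ∈ Complex.slitPlane) {u : ℝ} (hu : 0 ≤ u) :
    (u : ℂ) + w ∈ Complex.slitPlane := by
  rcases hw with h | h
  · left; simp; linarith
  · right; simpa using h

/-- Supplies the uniform lower bound needed to differentiate under the integral. If `w` near `w₀`
came too close to `-u`, then `-u` would lie in a ball inside the slit plane. Half of `ε` pays for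
moving `w`, half for the distance to `-u`. -/
theorem exists_le_norm_ofReal_add {w₀ : ℂ} (hw : w₀ ∈ Complex.slitPlane) :
    ∃ δ > 0, ∀ w ∈ Metric.ball w₀ δ, ∀ u ∈ Ioo (0 : ℝ) 1, δ ≤ ‖(u : ℂ) + w‖ := by
  obtain ⟨ε, hε, h⟩ := Metric.isOpen_iff.1 Complex.isOpen_slitPlane w₀ hw
  refine ⟨ε / 2, by positivity, fun w hw' u hu => ?_⟩
  by_contra! hlt
  have hmem : (-(u : ℂ)) ∈ Metric.ball w₀ ε := by
    rw [Metric.mem_ball, dist_eq_norm] at hw' ⊢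
    have : -(u : ℂ) - w₀ = (w - w₀) - (u + w) := by ring
    rw [this]
    linarith [norm_sub_le (w - w₀) ((u : ℂ) + w)]
  have := ofReal_add_mem_slitPlane (h hmem) hu.1.le
  simp at this

theorem continuousOn_stieltjes_integrand (hl0 : 0 < l) (hl1 : l < 1) (n : ℕ) {w : ℂ}
    (hw : w ∈ Complex.slitPlane) :
    ContinuousOn (fun u : ℝ => (kernelPrimitive l u : ℂ) * (((u : ℂ) + w) ^ n)⁻¹)
      (Icc 0 1) := by
  have hc := continuous_kernelPrimitive hl0 hl1
  refine ContinuousOn.mul (by fun_prop) (ContinuousOn.inv₀ (by fun_prop) fun u hu => ?_)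
  exact pow_ne_zero _ (Complex.slitPlane_ne_zero (ofReal_add_mem_slitPlane hw hu.1))

theorem integrableOn_stieltjes_integrand (hl0 : 0 < l) (hl1 : l < 1) (n : ℕ) {w : ℂ}
    (hw : w ∈ Complex.slitPlane) :
    IntegrableOn (fun u : ℝ => (kernelPrimitive l u : ℂ) * (((u : ℂ) + w) ^ n)⁻¹) (Ioo 0 1) :=
  ((continuousOn_stieltjes_integrand hl0 hl1 n hw).integrableOn_compact isCompact_Icc).mono_set
    Ioo_subset_Icc_self

theorem hasDerivAt_kernelStieltjes (hl0 : 0 < l) (hl1 : l < 1) (n : ℕ) {w : ℂ}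
    (hw : w ∈ Complex.slitPlane) :
    HasDerivAt (kernelStieltjes l n) (-(n + 1) * kernelStieltjes l (n + 1) w) w := by
  obtain ⟨δ, hδ, hb⟩ := exists_le_norm_ofReal_add hw
  have hs : Metric.ball w δ ∩ Complex.slitPlane ∈ 𝓝 w :=
    inter_mem (Metric.ball_mem_nhds w hδ) (Complex.isOpen_slitPlane.mem_nhds hw)
  have key := hasDerivAt_integral_of_dominated_loc_of_deriv_le (μ := volume.restrict (Ioo (0 : ℝ) 1))
    (F := fun w (u : ℝ) => (kernelPrimitive l u : ℂ) * (((u : ℂ) + w) ^ (n + 1))⁻¹)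
    (F' := fun w (u : ℝ) =>
      -(n + 1) * ((kernelPrimitive l u : ℂ) * (((u : ℂ) + w) ^ (n + 1 + 1))⁻¹))
    (bound := fun _ => (n + 1) * (δ ^ (n + 1 + 1))⁻¹) hs ?_
    (integrableOn_stieltjes_integrand hl0 hl1 (n + 1) hw)
    ((integrableOn_stieltjes_integrand hl0 hl1 (n + 1 + 1) hw).const_mul _).aestronglyMeasurable
    ?_ (integrable_const _) ?_
  · refine key.2.congr_deriv ?_
    rw [integral_const_mul]
    rfl
  · filter_upwards [hs] with w' hw'
    exact (integrableOn_stieltjes_integrand hl0 hl1 (n + 1) hw'.2).aestronglyMeasurable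
  · refine (ae_restrict_iff' measurableSet_Ioo).2 (.of_forall fun u hu w' hw' => ?_)
    have h1 := norm_kernelPrimitive_le_one hl0 hl1 hu
    have h2 : ‖(-((n : ℂ) + 1))‖ = n + 1 := by
      rw [norm_neg]; exact_mod_cast Complex.norm_natCast (n + 1)
    rw [norm_mul, norm_mul, norm_inv, norm_pow, h2]
    have h3 := hb w' hw'.1 u hu
    have h4 : (‖(u : ℂ) + w'‖ ^ (n + 1 + 1))⁻¹ ≤ (δ ^ (n + 1 + 1))⁻¹ := by gcongr
    calc _ ≤ ((n : ℝ) + 1) * (1 * (δ ^ (n + 1 + 1))⁻¹) := by gcongr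
      _ = _ := by ring
  · refine (ae_restrict_iff' measurableSet_Ioo).2 (.of_forall fun u hu w' hw' => ?_)
    have hne := Complex.slitPlane_ne_zero (ofReal_add_mem_slitPlane hw'.2 hu.1.le)
    have d := ((((hasDerivAt_id w').const_add (u : ℂ)).pow (n + 1)).inv
      (pow_ne_zero _ hne)).const_mul (kernelPrimitive l u : ℂ)
    refine d.congr_deriv ?_
    simp only [id, Pi.pow_apply]
    push_cast
    field_simp
    ring

theorem kernelPrimitive_moment (hl0 : 0 < l) (hl1 : l < 1) (n : ℕ) :
    ∫ u in Ioo (0 : ℝ) 1, kernelPrimitive l u * u ^ n =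
      Real.Gamma (n + 2 - l) * Real.Gamma (1 + l) / Real.Gamma (n + 3) := by
  have h := integral_beta (a := n + 2 - l) (b := 1 + l)
    (by have : (0 : ℝ) ≤ n := n.cast_nonneg
        linarith) (by linarith)
  rw [show (n : ℝ) + 2 - l + (1 + l) = n + 3 by ring] at h
  rw [← h]
  refine setIntegral_congr_fun measurableSet_Ioo fun u hu => ?_
  simp only [kernelPrimitive]
  rw [show (n : ℝ) + 2 - l - 1 = (1 - l) + n by ring, Real.rpow_add hu.1, Real.rpow_natCast,
    add_sub_cancel_left]
  ring

theorem Ring.choose_succ_mul (a : ℝ) (n : ℕ) :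
    Ring.choose a (n + 1) * (n + 1) = Ring.choose a n * (a - n) := by
  simp only [Ring.choose_eq_smul, descPochhammer_succ_right, Polynomial.smeval_mul,
    Polynomial.smeval_sub, Polynomial.smeval_X, Polynomial.smeval_natCast, smul_eq_mul,
    Nat.factorial_succ]
  have := Nat.factorial_ne_zero n
  push_cast
  field_simp
  simp

/-- The reflection formula settles `n = 0`; afterwards the recursion of Gamma matches that of the
generalized binomial coefficients. -/
theorem sin_div_pi_mul_moment (hl0 : 0 < l) (hl1 : l < 1) (n : ℕ) :
    Real.sin (l * Real.pi) / Real.pi * ∫ u in Ioo (0 : ℝ) 1, kernelPrimitive l u * u ^ n =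
      (-1) ^ (n + 1) * Ring.choose l (n + 2) := by
  rw [kernelPrimitive_moment hl0 hl1]
  induction n with
  | zero =>
    have hs : 0 < Real.sin (Real.pi * l) :=
      Real.sin_pos_of_pos_of_lt_pi (by positivity) (by nlinarith [Real.pi_pos])
    have hr := Real.Gamma_mul_Gamma_one_sub l
    have g1 : Real.Gamma (2 - l) = (1 - l) * Real.Gamma (1 - l) := by
      rw [← Real.Gamma_add_one (by linarith)]; ring_nf
    have g2 : Real.Gamma (1 + l) = l * Real.Gamma l := by
      rw [← Real.Gamma_add_one hl0.ne']; ring_nf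
    have c1 := Ring.choose_succ_mul l 1
    rw [Ring.choose_one_right] at c1
    norm_num at c1
    norm_num
    rw [g1, g2, mul_comm l Real.pi]
    have : (1 - l) * Real.Gamma (1 - l) * (l * Real.Gamma l) =
      (1 - l) * l * (Real.pi / Real.sin (Real.pi * l)) := by rw [← hr]; ring
    rw [this]
    have := Real.pi_pos
    field_simp
    linarith
  | succ n ih =>
    have hn : (0 : ℝ) ≤ n := n.cast_nonneg
    have g1 : Real.Gamma ((n + 1 : ℕ) + 2 - l) = (n + 2 - l) * Real.Gamma (n + 2 - l) := by
      rw [← Real.Gamma_add_one (by linarith)]; push_cast; ring_nf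
    have g3 : Real.Gamma ((n + 1 : ℕ) + 3) = (n + 3) * Real.Gamma (n + 3) := by
      rw [← Real.Gamma_add_one (by linarith)]; push_cast; ring_nf
    have c := Ring.choose_succ_mul l (n + 2)
    push_cast at c
    have c' : Ring.choose l (n + 1 + 2) = Ring.choose l (n + 2) * (l - (n + 2)) / (n + 3) := by
      rw [eq_div_iff (by linarith), ← c]; ring_nf
    have : Real.sin (l * Real.pi) / Real.pi * ((n + 2 - l) * Real.Gamma (n + 2 - l) *
        Real.Gamma (1 + l) / ((n + 3) * Real.Gamma (n + 3))) = (n + 2 - l) / (n + 3) *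
        (Real.sin (l * Real.pi) / Real.pi * (Real.Gamma (n + 2 - l) * Real.Gamma (1 + l) /
          Real.Gamma (n + 3))) := by
      rw [mul_assoc (_ - l), mul_div_mul_comm]
      ring
    rw [g1, g3, this, ih, c']
    ring

end Stieltjes

/-! ### The Stieltjes representation, first for `w > 1`, then on the slit plane. -/

section Representation

variable {l : ℝ}

/-- The binomial series at `1/w` without its first two terms `1 + l/w`, multiplied by `w`. -/
theorem hasSum_binomial_tail (l : ℝ) {w : ℝ} (hw : 1 < w) :
    HasSum (fun n : ℕ => Ring.choose l (n + 2) * (w ^ (n + 1))⁻¹)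
      (w * (1 + w⁻¹) ^ l - w - l) := by
  have h0 : 0 < w := by linarith
  have hmem : w⁻¹ ∈ Metric.eball (0 : ℝ) 1 := by
    rw [← ENNReal.ofReal_one, Metric.eball_ofReal]
    simpa [abs_of_pos h0] using inv_lt_one_of_one_lt₀ hw
  have h := (Real.one_add_rpow_hasFPowerSeriesOnBall_zero (a := l)).hasSum hmem
  simp only [binomialSeries_apply, zero_add] at h
  have h' : HasSum (fun n : ℕ => Ring.choose l n * (w⁻¹) ^ n) ((1 + w⁻¹) ^ l) := by
    simpa using h
  have h2 := ((hasSum_nat_add_iff' 2).2 h').mul_left w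
  convert! h2 using 1
  · funext n
    rw [inv_pow, pow_succ w (n + 1)]
    field_simp
  · simp [Finset.sum_range_succ]
    field_simp
    ring

/-- Expand `1/(u+w)` geometrically in `u/w`; since `k(u) u^n ≤ 1`, the summable constants
`w^{-(n+1)}` dominate. -/
theorem hasSum_stieltjes (hl0 : 0 < l) (hl1 : l < 1) {w : ℝ} (hw : 1 < w) :
    HasSum (fun n : ℕ => (∫ u in Ioo (0 : ℝ) 1, kernelPrimitive l u * u ^ n) *
        ((-1) ^ n * (w ^ (n + 1))⁻¹))
      (∫ u in Ioo (0 : ℝ) 1, kernelPrimitive l u * (u + w)⁻¹) := by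
  have h0 : 0 < w := by linarith
  have hc := continuous_kernelPrimitive hl0 hl1
  simp_rw [← integral_mul_const]
  have hsum : Summable fun n : ℕ => (w ^ (n + 1))⁻¹ := by
    simp_rw [← inv_pow]
    exact (summable_nat_add_iff 1).2
      (summable_geometric_of_lt_one (by positivity) (inv_lt_one_of_one_lt₀ hw))
  refine hasSum_integral_of_dominated_convergence (fun n _ => (w ^ (n + 1))⁻¹) (fun n => ?_)
    (fun n => ?_) (.of_forall fun _ => hsum) (integrable_const _) ?_
  · exact (by fun_prop : Continuous fun u : ℝ =>
      kernelPrimitive l u * u ^ n * ((-1) ^ n * (w ^ (n + 1))⁻¹)).aestronglyMeasurable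
  · refine (ae_restrict_iff' measurableSet_Ioo).2 (.of_forall fun u hu => ?_)
    have h1 := kernelPrimitive_le_one hl0 hl1 hu
    have h2 := (kernelPrimitive_pos (l := l) hu).le
    have h3 : u ^ n ≤ 1 := pow_le_one₀ hu.1.le hu.2.le
    have h4 : 0 ≤ u ^ n := pow_nonneg hu.1.le n
    rw [norm_mul, norm_mul, norm_mul, norm_pow (-1 : ℝ), norm_neg, norm_one, one_pow, one_mul,
      Real.norm_of_nonneg h2, Real.norm_of_nonneg h4, Real.norm_of_nonneg (by positivity)]
    exact mul_le_of_le_one_left (by positivity) (mul_le_one₀ h1 h4 h3)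
  · refine (ae_restrict_iff' measurableSet_Ioo).2 (.of_forall fun u hu => ?_)
    have hu0 := hu.1
    have hlt : |-(u / w)| < 1 := by
      rw [abs_neg, abs_of_pos (by positivity), div_lt_one h0]; linarith [hu.2]
    have hg := (hasSum_geometric_of_abs_lt_one hlt).mul_left (kernelPrimitive l u * w⁻¹)
    convert! hg using 1
    · funext n
      rw [neg_pow (u / w), div_pow, pow_succ]
      field_simp
    · rw [mul_assoc, ← mul_inv]
      congr 2
      field_simp
      ring

theorem rpow_mul_rpow_eq_stieltjes (hl0 : 0 < l) (hl1 : l < 1) {w : ℝ} (hw : 1 < w) :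
    (1 + w) ^ l * w ^ (1 - l) = w + l - Real.sin (l * Real.pi) / Real.pi *
      ∫ u in Ioo (0 : ℝ) 1, kernelPrimitive l u * (u + w)⁻¹ := by
  have h0 : 0 < w := by linarith
  have h1 := (hasSum_stieltjes hl0 hl1 hw).mul_left (-(Real.sin (l * Real.pi) / Real.pi))
  have h2 := hasSum_binomial_tail l hw
  have e : ∀ n : ℕ, -(Real.sin (l * Real.pi) / Real.pi) *
      ((∫ u in Ioo (0 : ℝ) 1, kernelPrimitive l u * u ^ n) * ((-1) ^ n * (w ^ (n + 1))⁻¹)) =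
      Ring.choose l (n + 2) * (w ^ (n + 1))⁻¹ := fun n => by
    have hm := sin_div_pi_mul_moment hl0 hl1 n
    have hsq : ((-1 : ℝ) ^ n) * (-1) ^ n = 1 := by rw [← mul_pow]; simp
    rw [neg_mul, ← mul_assoc, hm, pow_succ]
    linear_combination Ring.choose l (n + 2) * (w ^ (n + 1))⁻¹ * hsq
  simp_rw [e] at h1
  have h3 := h2.unique h1
  have h4 : (1 + w) ^ l * w ^ (1 - l) = w * (1 + w⁻¹) ^ l := by
    rw [show 1 + w⁻¹ = (1 + w) / w by field_simp; ring, Real.div_rpow (by linarith) h0.le,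
      Real.rpow_sub h0, Real.rpow_one]
    ring
  rw [h4]
  linarith

theorem kernelStieltjes_ofReal (n : ℕ) (w : ℝ) :
    kernelStieltjes l n w =
      ((∫ u in Ioo (0 : ℝ) 1, kernelPrimitive l u * ((u + w) ^ (n + 1))⁻¹ : ℝ) : ℂ) := by
  rw [kernelStieltjes, ← integral_complex_ofReal]
  push_cast
  rfl

theorem cpow_ofReal_mul_cpow_ofReal {a b : ℝ} (ha : 0 ≤ a) (hb : 0 ≤ b) (l : ℝ) :
    (a : ℂ) ^ (l : ℂ) * (b : ℂ) ^ ((1 - l : ℝ) : ℂ) = ((a ^ l * b ^ (1 - l) : ℝ) : ℂ) := by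
  rw [Complex.ofReal_mul, Complex.ofReal_cpow ha, Complex.ofReal_cpow hb]

theorem differentiableAt_cpow_mul_cpow (l : ℝ) {w : ℂ} (hw : w ∈ Complex.slitPlane) :
    DifferentiableAt ℂ (fun w : ℂ => (1 + w) ^ (l : ℂ) * w ^ ((1 - l : ℝ) : ℂ)) w := by
  have h1 : (1 : ℂ) + w ∈ Complex.slitPlane := by
    simpa using ofReal_add_mem_slitPlane hw zero_le_one
  exact ((differentiableAt_id.const_add 1).cpow_const h1).mul (differentiableAt_id.cpow_const hw)

/-- The Stieltjes representation of `(1+w)^l w^(1-l)` on the slit plane. -/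
theorem cpow_mul_cpow_eq_stieltjes (hl0 : 0 < l) (hl1 : l < 1) {w : ℂ}
    (hw : w ∈ Complex.slitPlane) :
    (1 + w) ^ (l : ℂ) * w ^ ((1 - l : ℝ) : ℂ) =
      w + l - ((Real.sin (l * Real.pi) / Real.pi : ℝ) : ℂ) * kernelStieltjes l 0 w := by
  have hf : AnalyticOnNhd ℂ (fun w : ℂ => (1 + w) ^ (l : ℂ) * w ^ ((1 - l : ℝ) : ℂ))
      Complex.slitPlane :=
    DifferentiableOn.analyticOnNhd
      (fun w hw => (differentiableAt_cpow_mul_cpow l hw).differentiableWithinAt)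
      Complex.isOpen_slitPlane
  have hg : AnalyticOnNhd ℂ (fun w : ℂ =>
      w + l - ((Real.sin (l * Real.pi) / Real.pi : ℝ) : ℂ) * kernelStieltjes l 0 w)
      Complex.slitPlane :=
    DifferentiableOn.analyticOnNhd
      (fun w hw => (((differentiableAt_id.add_const _).sub
        ((hasDerivAt_kernelStieltjes hl0 hl1 0 hw).differentiableAt.const_mul
          _))).differentiableWithinAt)
      Complex.isOpen_slitPlane
  have hreal : ∀ w : ℝ, 1 < w → (1 + (w : ℂ)) ^ (l : ℂ) * (w : ℂ) ^ ((1 - l : ℝ) : ℂ) =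
      w + l - ((Real.sin (l * Real.pi) / Real.pi : ℝ) : ℂ) * kernelStieltjes l 0 w := by
    intro w hw
    have := cpow_ofReal_mul_cpow_ofReal (a := 1 + w) (b := w) (by linarith) (by linarith) l
    rw [Complex.ofReal_add, Complex.ofReal_one] at this
    rw [this, rpow_mul_rpow_eq_stieltjes hl0 hl1 hw, kernelStieltjes_ofReal]
    simp only [zero_add, pow_one]
    push_cast
    rfl
  have h2 : (2 : ℂ) ∈ Complex.slitPlane := Or.inl (by norm_num)
  refine hf.eqOn_of_preconnected_of_frequently_eq hg
    (Complex.starConvex_one_slitPlane.isPathConnected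
      Complex.one_mem_slitPlane).isConnected.isPreconnected h2 ?_ hw
  -- Agreement on reals close to `2` gives agreement at points accumulating at `2`, as the identity
  -- theorem requires.
  have ht : Tendsto (fun x : ℝ => (x : ℂ)) (𝓝[≠] 2) (𝓝[≠] 2) := by
    refine tendsto_nhdsWithin_of_tendsto_nhds_of_eventually_within _ ?_ ?_
    · exact (Complex.continuous_ofReal.tendsto' 2 2 (by norm_num)).mono_left nhdsWithin_le_nhds
    · filter_upwards [self_mem_nhdsWithin] with x hx h
      exact hx (Complex.ofReal_injective (by simpa using h))
  refine ht.frequently (Eventually.frequently ?_)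
  filter_upwards [nhdsWithin_le_nhds (Ioi_mem_nhds (show (1 : ℝ) < 2 by norm_num))] with x hx
  exact hreal x hx

end Representation

/-! ### Fubini along a ray. -/

section Ray

variable {l : ℝ}

theorem integrableOn_kernelPrimitive_div (hl0 : 0 < l) (hl1 : l < 1) :
    IntegrableOn (fun u => kernelPrimitive l u / u) (Ioo 0 1) := by
  have h := integrableOn_beta (a := 1 - l) (b := l + 1) (by linarith) (by linarith)
  refine h.congr_fun (fun u hu => ?_) measurableSet_Ioo
  simp only [kernelPrimitive, add_sub_cancel_right, Real.rpow_sub_one hu.1.ne']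
  ring

theorem integrableOn_exp_neg_mul {c : ℂ} (hc : 0 < c.re) :
    IntegrableOn (fun r : ℝ => Complex.exp (-(c * r))) (Ioi 0) := by
  simpa [neg_mul] using integrableOn_exp_mul_complex_Ioi (a := -c) (by simpa) 0

theorem integral_exp_neg_mul {c : ℂ} (hc : 0 < c.re) :
    ∫ r in Ioi (0 : ℝ), Complex.exp (-(c * r)) = c⁻¹ := by
  have h := integral_exp_mul_complex_Ioi (a := -c) (by simpa) 0
  simpa [neg_mul, neg_div] using h

theorem integral_norm_exp_neg_mul {c : ℂ} (hc : 0 < c.re) :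
    ∫ r in Ioi (0 : ℝ), ‖Complex.exp (-(c * r))‖ = c.re⁻¹ := by
  have h := integral_exp_mul_Ioi (a := -c.re) (by simpa) 0
  simp_rw [Complex.norm_exp]
  simpa [neg_mul, neg_div] using h

/-- The Laplace transform of `u^(1-l) (1-u)^l`, integrated against an exponential along a ray. -/
theorem integral_ray_laplace (hl0 : 0 < l) (hl1 : l < 1) {d : ℝ} (hd : 0 < d) {ω b : ℂ}
    (hω : 0 < ω.re) (hb : 0 ≤ (ω * b).re) :
    IntegrableOn (fun r : ℝ => ∫ u in Ioo (0 : ℝ) 1,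
      ω * d * (kernelPrimitive l u : ℂ) * Complex.exp (-(ω * (u * d + b) * r))) (Ioi 0) ∧
    ∫ r in Ioi (0 : ℝ), ∫ u in Ioo (0 : ℝ) 1,
      ω * d * (kernelPrimitive l u : ℂ) * Complex.exp (-(ω * (u * d + b) * r)) =
      kernelStieltjes l 0 (b / d) := by
  have hcont := continuous_kernelPrimitive hl0 hl1
  have hre : ∀ u : ℝ, (ω * (u * d + b)).re = u * d * ω.re + (ω * b).re := fun u => by
    have : ω * (u * d + b) = ((u * d : ℝ) : ℂ) * ω + ω * b := by push_cast; ring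
    rw [this, Complex.add_re, Complex.re_ofReal_mul]
  have hpos : ∀ u ∈ Ioo (0 : ℝ) 1, 0 < (ω * (u * d + b)).re := fun u hu => by
    have := hu.1
    rw [hre]; positivity
  have hmeas : Continuous (Function.uncurry fun (r u : ℝ) =>
      ω * d * (kernelPrimitive l u : ℂ) * Complex.exp (-(ω * (u * d + b) * r))) := by
    unfold Function.uncurry
    fun_prop
  have hint : Integrable (Function.uncurry fun (r u : ℝ) =>
      ω * d * (kernelPrimitive l u : ℂ) * Complex.exp (-(ω * (u * d + b) * r)))
      ((volume.restrict (Ioi 0)).prod (volume.restrict (Ioo 0 1))) := by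
    rw [integrable_prod_iff' hmeas.aestronglyMeasurable]
    refine ⟨?_, ?_⟩
    · refine (ae_restrict_iff' measurableSet_Ioo).2 (.of_forall fun u hu => ?_)
      exact (integrableOn_exp_neg_mul (hpos u hu)).const_mul
        (ω * d * (kernelPrimitive l u : ℂ))
    -- Integrating the norm over `r` produces `1/Re(ω(ud+b))`, at most `1/(u d Re ω)` since `Re(ωb)
    -- ≥ 0`. The integrable majorant is thus a multiple of `k(u)/u`, which also covers the boundary
    -- case `Re(ωb) = 0`.
    · refine Integrable.mono' ((integrableOn_kernelPrimitive_div hl0 hl1).const_mul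
        (‖ω‖ / ω.re)) ?_ ?_
      · exact (hmeas.norm.aestronglyMeasurable (μ := (volume.restrict (Ioi 0)).prod
          (volume.restrict (Ioo 0 1)))).prod_swap.integral_prod_right'
      · refine (ae_restrict_iff' measurableSet_Ioo).2 (.of_forall fun u hu => ?_)
        have hu0 := hu.1
        have hk := kernelPrimitive_pos (l := l) hu
        simp only [Function.uncurry, norm_mul]
        rw [integral_const_mul, integral_norm_exp_neg_mul (hpos u hu), Complex.norm_real,
          Complex.norm_real, Real.norm_of_nonneg hd.le, Real.norm_of_nonneg hk.le,
          Real.norm_of_nonneg (by have := hpos u hu; positivity), hre]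
        calc ‖ω‖ * d * kernelPrimitive l u * (u * d * ω.re + (ω * b).re)⁻¹
            ≤ ‖ω‖ * d * kernelPrimitive l u * (u * d * ω.re)⁻¹ := by
              gcongr
              linarith
          _ = ‖ω‖ / ω.re * (kernelPrimitive l u / u) := by field_simp
  refine ⟨hint.integral_prod_left, ?_⟩
  rw [integral_integral_swap hint, kernelStieltjes]
  refine setIntegral_congr_fun measurableSet_Ioo fun u hu => ?_
  have hω0 : ω ≠ 0 := fun h => by simp [h] at hω
  have hd0 : (d : ℂ) ≠ 0 := by exact_mod_cast hd.ne'
  have hne : ω * (u * d + b) ≠ 0 := fun h => by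
    have := hpos u hu
    simp [h] at this
  have hne' := right_ne_zero_of_mul hne
  simp only [zero_add, pow_one]
  rw [integral_const_mul, integral_exp_neg_mul (hpos u hu)]
  have e : (u : ℂ) + b / d = (u * d + b) / d := by field_simp
  rw [e]
  field_simp

/-- Integration by parts cancels the division by `s = ωr`, and `e^{-sy}(1 - e^{-sz})` splits into
exponentials with shifts `y` and `y + z`. -/
theorem alongRay_meanIntegrandC_eq (hl0 : 0 < l) (hl1 : l < 1) (x y : ℝ) (z : ℂ) {ω : ℂ}
    (hω : ω ≠ 0) {r : ℝ} (hr : r ≠ 0) :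
    alongRay (meanIntegrandC x y l z) ω r =
      (∫ u in Ioo (0 : ℝ) 1, ω * (x - y : ℝ) * (kernelPrimitive l u : ℂ) *
        Complex.exp (-(ω * (u * (x - y : ℝ) + y) * r))) -
      ∫ u in Ioo (0 : ℝ) 1, ω * (x - y : ℝ) * (kernelPrimitive l u : ℂ) *
        Complex.exp (-(ω * (u * (x - y : ℝ) + (y + z)) * r)) := by
  have hr' : (r : ℂ) ≠ 0 := by exact_mod_cast hr
  have e : ∀ b : ℂ, ∫ u in Ioo (0 : ℝ) 1, ω * (x - y : ℝ) * (kernelPrimitive l u : ℂ) *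
      Complex.exp (-(ω * (u * (x - y : ℝ) + b) * r)) =
      ω * (x - y : ℝ) * Complex.exp (-(ω * r * b)) * ∫ u in Ioo (0 : ℝ) 1,
        (kernelPrimitive l u : ℂ) * Complex.exp (-((u : ℂ) * ((x - y : ℝ) * (ω * r)))) := by
    intro b
    rw [← integral_const_mul]
    congr 1
    funext u
    rw [show -(ω * (u * (x - y : ℝ) + b) * r) =
      -(ω * r * b) + -((u : ℂ) * ((x - y : ℝ) * (ω * r))) by ring, Complex.exp_add]
    ring
  rw [e, e, alongRay, meanIntegrandC, kernelFC_eq_mul_integral hl0 hl1,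
    show -(ω * r * ((y : ℂ) + z)) = -(ω * r * y) + -(ω * r * z) by ring, Complex.exp_add]
  field_simp

theorem integral_alongRay (hl0 : 0 < l) (hl1 : l < 1) {x y : ℝ} (hy : 0 < y) (hxy : y < x)
    {z ω : ℂ} (hω : 0 < ω.re) (hz : 0 ≤ (ω * ((y : ℂ) + z)).re) :
    IntegrableOn (alongRay (meanIntegrandC x y l z) ω) (Ioi 0) ∧
    ∫ r in Ioi (0 : ℝ), alongRay (meanIntegrandC x y l z) ω r =
      kernelStieltjes l 0 (y / (x - y : ℝ)) - kernelStieltjes l 0 ((y + z) / (x - y : ℝ)) := by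
  have hd : 0 < x - y := by linarith
  have hω0 : ω ≠ 0 := fun h => by simp [h] at hω
  have hy' : 0 ≤ (ω * (y : ℂ)).re := by
    rw [Complex.re_mul_ofReal]; positivity
  obtain ⟨i1, e1⟩ := integral_ray_laplace hl0 hl1 hd hω hy'
  obtain ⟨i2, e2⟩ := integral_ray_laplace hl0 hl1 hd hω hz
  have hcongr : EqOn _ (alongRay (meanIntegrandC x y l z) ω) (Ioi 0) := fun r hr =>
    (alongRay_meanIntegrandC_eq hl0 hl1 x y z hω0 (ne_of_gt hr)).symm
  refine ⟨(i1.sub i2).congr_fun hcongr measurableSet_Ioi, ?_⟩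
  rw [← setIntegral_congr_fun measurableSet_Ioi hcongr, integral_sub i1 i2, e1, e2]

theorem meanIntegrand_eq_alongRay_one (x y : ℝ) (z : ℂ) :
    meanIntegrand x y l z = alongRay (meanIntegrandC x y l z) 1 := by
  funext r
  rw [alongRay, meanIntegrand, meanIntegrandC, one_mul, mul_one, ← Complex.ofReal_mul,
    kernelFC_ofReal]
  push_cast
  rfl

end Ray

/-! ### The complex mean and its integral representation. -/

section Mean

variable {l : ℝ}

theorem add_mem_slitPlane_of_mem_slitAt {y : ℝ} {z : ℂ} (hz : z ∈ slitAt y) :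
    (y : ℂ) + z ∈ Complex.slitPlane := by
  by_contra h
  rw [Complex.mem_slitPlane_iff, not_or, not_lt, not_not] at h
  refine hz ⟨z.re, ?_, ?_⟩
  · have := h.1
    simp only [Complex.add_re, Complex.ofReal_re] at this
    simp only [mem_Iic]
    linarith
  · have := h.2
    simp only [Complex.add_im, Complex.ofReal_im, zero_add] at this
    exact Complex.ext (by simp) (by simp [this])

/-- A positive factor leaves the argument unchanged, so no branch correction appears. -/
theorem ofReal_mul_cpow {a : ℝ} (ha : 0 < a) {w : ℂ} (hw : w ≠ 0) (c : ℂ) :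
    ((a : ℂ) * w) ^ c = (a : ℂ) ^ c * w ^ c := by
  have ha' : (a : ℂ) ≠ 0 := by exact_mod_cast ha.ne'
  rw [Complex.cpow_def_of_ne_zero (mul_ne_zero ha' hw), Complex.cpow_def_of_ne_zero ha',
    Complex.cpow_def_of_ne_zero hw, Complex.log_ofReal_mul ha hw, ← Complex.exp_add,
    Complex.ofReal_log ha.le]
  ring_nf

theorem div_ofReal_mem_slitPlane {d : ℝ} (hd : 0 < d) {w : ℂ} (hw : w ∈ Complex.slitPlane) :
    w / d ∈ Complex.slitPlane := by
  rcases hw with h | h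
  · left; rw [Complex.div_ofReal_re]; positivity
  · right; rw [Complex.div_ofReal_im]; exact div_ne_zero h hd.ne'

theorem weightedGeomC_eq_stieltjes (hl0 : 0 < l) (hl1 : l < 1) {x y : ℝ} (hxy : y < x) {z : ℂ}
    (hz : (y : ℂ) + z ∈ Complex.slitPlane) :
    weightedGeomC x y l z = y + z + (x - y : ℝ) * l -
      (x - y : ℝ) * (((Real.sin (l * Real.pi) / Real.pi : ℝ) : ℂ) *
        kernelStieltjes l 0 ((y + z) / (x - y : ℝ))) := by
  have hd : 0 < x - y := by linarith
  have hd0 : ((x - y : ℝ) : ℂ) ≠ 0 := by exact_mod_cast hd.ne'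
  have hw := div_ofReal_mem_slitPlane hd hz
  have h1 : (1 : ℂ) + (y + z) / (x - y : ℝ) ∈ Complex.slitPlane := by
    simpa using ofReal_add_mem_slitPlane hw zero_le_one
  have hx : (x : ℂ) + z = (x - y : ℝ) * (1 + (y + z) / (x - y : ℝ)) := by
    field_simp
    push_cast
    ring
  have hy : (y : ℂ) + z = (x - y : ℝ) * ((y + z) / (x - y : ℝ)) := by field_simp
  -- The exponents sum to `1`, so the mean is homogeneous of degree one under positive scaling.
  have hone : ((x - y : ℝ) : ℂ) ^ (l : ℂ) * ((x - y : ℝ) : ℂ) ^ ((1 - l : ℝ) : ℂ) =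
      (x - y : ℝ) := by
    rw [← Complex.cpow_add _ _ hd0]
    simp
  have key := cpow_mul_cpow_eq_stieltjes hl0 hl1 hw
  rw [weightedGeomC, hx]
  conv_lhs => rw [hy]
  rw [mul_div_cancel_left₀ _ hd0, ofReal_mul_cpow hd (Complex.slitPlane_ne_zero h1),
    ofReal_mul_cpow hd (Complex.slitPlane_ne_zero hw)]
  calc _ = (((x - y : ℝ) : ℂ) ^ (l : ℂ) * ((x - y : ℝ) : ℂ) ^ ((1 - l : ℝ) : ℂ)) *
        ((1 + (y + z) / (x - y : ℝ)) ^ (l : ℂ) *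
          ((y + z) / (x - y : ℝ)) ^ ((1 - l : ℝ) : ℂ)) := by ring
    _ = _ := by
      rw [hone, key]
      field_simp

theorem weightedGeomC_ofReal {x y : ℝ} (hxy : y < x) {t : ℝ} (ht : -y < t) :
    weightedGeomC x y l t = (weightedGeom x y l t : ℂ) := by
  rw [weightedGeomC, weightedGeom, ← Complex.ofReal_add, ← Complex.ofReal_add]
  exact cpow_ofReal_mul_cpow_ofReal (by linarith) (by linarith) l

theorem weightedGeomC_eq_add_integral (hl0 : 0 < l) (hl1 : l < 1) {x y : ℝ} (hy : 0 < y)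
    (hxy : y < x) {z ω : ℂ} (hz : z ∈ slitAt y) (hω : 0 < ω.re)
    (hωz : 0 ≤ (ω * ((y : ℂ) + z)).re) :
    weightedGeomC x y l z = ((x ^ l * y ^ (1 - l) : ℝ) : ℂ) + z +
      ((Real.sin (l * Real.pi) / Real.pi * (x - y) : ℝ) : ℂ) *
        ∫ r in Ioi (0 : ℝ), alongRay (meanIntegrandC x y l z) ω r := by
  -- The constant term is the mean at `z = 0`; subtracting its Stieltjes formula leaves `z` and a
  -- difference of two values of `S`.
  have h0 : ((x ^ l * y ^ (1 - l) : ℝ) : ℂ) = weightedGeomC x y l 0 := by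
    have := weightedGeomC_ofReal (l := l) hxy (t := 0) (by linarith)
    rw [Complex.ofReal_zero] at this
    rw [this, weightedGeom, add_zero, add_zero]
  have hy' : (y : ℂ) + 0 ∈ Complex.slitPlane := Or.inl (by simpa)
  rw [h0, weightedGeomC_eq_stieltjes hl0 hl1 hxy (add_mem_slitPlane_of_mem_slitAt hz),
    weightedGeomC_eq_stieltjes hl0 hl1 hxy hy', (integral_alongRay hl0 hl1 hy hxy hω hωz).2,
    add_zero]
  push_cast
  ring

theorem differentiableOn_weightedGeomC {x y : ℝ} (hxy : y < x) :
    DifferentiableOn ℂ (weightedGeomC x y l) (slitAt y) := by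
  intro z hz
  have h1 := add_mem_slitPlane_of_mem_slitAt hz
  have h2 : (x : ℂ) + z ∈ Complex.slitPlane := by
    have := ofReal_add_mem_slitPlane h1 (u := x - y) (by linarith)
    rwa [← add_assoc, ← Complex.ofReal_add, sub_add_cancel] at this
  exact (((differentiableAt_id.const_add _).cpow_const h2).mul
    ((differentiableAt_id.const_add _).cpow_const h1)).differentiableWithinAt

theorem exists_ray {w : ℂ} (hw : w ∈ Complex.slitPlane) :
    ∃ ω : ℂ, 0 < ω.re ∧ 0 < (ω * w).re := by
  have hn : 0 < ‖w‖ := norm_pos_iff.2 (Complex.slitPlane_ne_zero hw)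
  have hp : 0 < ‖w‖ + w.re := by
    rcases hw with h | h
    · positivity
    · have := Complex.abs_re_lt_norm.2 h
      linarith [neg_abs_le w.re]
  -- This `ω` bisects the directions of `1` and `conj w`: `Re ω = ‖w‖ + Re w` and `Re(ωw) = ‖w‖ (‖w‖
  -- + Re w)`, both positive off the cut.
  refine ⟨(starRingEnd ℂ) w + ‖w‖, by simpa [add_comm] using hp, ?_⟩
  rw [add_mul, mul_comm _ w, Complex.mul_conj, Complex.add_re, Complex.re_ofReal_mul,
    Complex.ofReal_re, Complex.normSq_eq_norm_sq]
  nlinarith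

end Mean

/-! ### The Bernstein property. -/

section Bernstein

variable {l : ℝ}

theorem iteratedDeriv_eqOn_of_hasDerivAt {I : Set ℝ} (hI : IsOpen I) {f : ℝ → ℝ}
    {D : ℕ → ℝ → ℝ} (h0 : EqOn f (D 0) I)
    (hD : ∀ k, ∀ t ∈ I, HasDerivAt (D k) (D (k + 1) t) t) (k : ℕ) :
    EqOn (iteratedDeriv k f) (D k) I := by
  induction k with
  | zero => simpa using h0
  | succ k ih =>
    intro t ht
    rw [iteratedDeriv_succ, (ih.eventuallyEq_of_mem (hI.mem_nhds ht)).deriv_eq]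
    exact (hD k t ht).deriv

theorem isBernsteinOn_of_hasDerivAt {I : Set ℝ} (hI : IsOpen I) {f : ℝ → ℝ}
    {D : ℕ → ℝ → ℝ} (hf : ∀ t ∈ I, 0 ≤ f t) (hs : ContDiffOn ℝ (⊤ : ℕ∞) f I)
    (h0 : EqOn f (D 0) I) (hD : ∀ k, ∀ t ∈ I, HasDerivAt (D k) (D (k + 1) t) t)
    (hsign : ∀ k, ∀ t ∈ I, 0 ≤ (-1 : ℝ) ^ k * D (k + 1) t) : IsBernsteinOn f I := by
  refine ⟨hf, hs, hs.deriv_of_isOpen hI (by simp), fun k t ht => ?_⟩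
  rw [← iteratedDeriv_succ', iteratedDeriv_eqOn_of_hasDerivAt hI h0 hD (k + 1) ht]
  exact hsign k t ht

theorem weightedGeom_nonneg {x y t : ℝ} (hx : 0 < x + t) (hy : 0 < y + t) :
    0 ≤ weightedGeom x y l t :=
  mul_nonneg (Real.rpow_nonneg hx.le _) (Real.rpow_nonneg hy.le _)

theorem contDiffOn_weightedGeom {x y : ℝ} (hyx : y ≤ x) :
    ContDiffOn ℝ (⊤ : ℕ∞) (weightedGeom x y l) (Ioi (-y)) := by
  intro t ht
  have ht' : -y < t := ht
  have hx : x + t ≠ 0 := by linarith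
  have hy : y + t ≠ 0 := by linarith
  exact (((contDiffAt_const.add contDiffAt_id).rpow_const_of_ne hx).mul
    ((contDiffAt_const.add contDiffAt_id).rpow_const_of_ne hy)).contDiffWithinAt

/-- The successive derivatives of `t ↦ y + t + d l - d c ∫_0^1 u^(1-l) (1-u)^l / (u+(y+t)/d) du`. -/
noncomputable def stieltjesDeriv (l y d c : ℝ) : ℕ → ℝ → ℝ
  | 0, t => y + t + d * l - d * (c * (kernelStieltjes l 0 ((y + t) / d : ℝ)).re)
  -- The chain rule gives `d^(k+1)` in the denominator, and the outer factor `d` cancels one power.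
  -- The linear term `t` contributes only to the first derivative, `k = 0`.
  | k + 1, t => (if k = 0 then 1 else 0) + (-1) ^ k * (k + 1).factorial * c / d ^ k *
      (kernelStieltjes l (k + 1) ((y + t) / d : ℝ)).re

theorem kernelStieltjes_re_nonneg (n : ℕ) {w : ℝ} (hw : 0 < w) :
    0 ≤ (kernelStieltjes l n w).re := by
  rw [kernelStieltjes_ofReal, Complex.ofReal_re]
  refine setIntegral_nonneg measurableSet_Ioo fun u hu => ?_
  have := hu.1
  have := (kernelPrimitive_pos (l := l) hu).le
  positivity

theorem hasDerivAt_kernelStieltjes_re (hl0 : 0 < l) (hl1 : l < 1) (n : ℕ) {y d : ℝ} (hd : 0 < d)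
    {t : ℝ} (ht : 0 < y + t) :
    HasDerivAt (fun t : ℝ => (kernelStieltjes l n ((y + t) / d : ℝ)).re)
      (-(n + 1) * (kernelStieltjes l (n + 1) ((y + t) / d : ℝ)).re / d) t := by
  have hw : (((y + t) / d : ℝ) : ℂ) ∈ Complex.slitPlane :=
    Or.inl (by rw [Complex.ofReal_re]; positivity)
  have h1 := (hasDerivAt_kernelStieltjes hl0 hl1 n hw).real_of_complex
  have h2 : HasDerivAt (fun t : ℝ => (y + t) / d) (1 / d) t :=
    ((hasDerivAt_id t).const_add y).div_const d
  refine (h1.comp t h2).congr_deriv ?_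
  rw [show (-((n : ℂ) + 1)) = ((-(n + 1) : ℝ) : ℂ) by push_cast; ring, Complex.re_ofReal_mul]
  ring

theorem hasDerivAt_stieltjesDeriv (hl0 : 0 < l) (hl1 : l < 1) {y d : ℝ} (c : ℝ) (hd : 0 < d)
    (k : ℕ) {t : ℝ} (ht : 0 < y + t) :
    HasDerivAt (stieltjesDeriv l y d c k) (stieltjesDeriv l y d c (k + 1) t) t := by
  cases k with
  | zero =>
    have h := hasDerivAt_kernelStieltjes_re hl0 hl1 0 hd ht
    refine ((((hasDerivAt_id t).const_add y).add_const (d * l)).sub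
      ((h.const_mul c).const_mul d)).congr_deriv ?_
    simp only [stieltjesDeriv, if_true]
    push_cast
    simp only [zero_add, Nat.factorial, pow_zero]
    field_simp
    simp
  | succ k =>
    have h := hasDerivAt_kernelStieltjes_re hl0 hl1 (k + 1) hd ht
    refine ((h.const_mul ((-1) ^ k * (k + 1).factorial * c / d ^ k)).const_add
      (if k = 0 then 1 else 0)).congr_deriv ?_
    simp only [stieltjesDeriv, Nat.add_eq_zero_iff, one_ne_zero, and_false, if_false, zero_add]
    rw [Nat.factorial_succ (k + 1), pow_succ, pow_succ]
    push_cast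
    field_simp

theorem stieltjesDeriv_sign {y d c : ℝ} (hd : 0 < d) (hc : 0 ≤ c) (k : ℕ) {t : ℝ}
    (ht : 0 < y + t) : 0 ≤ (-1 : ℝ) ^ k * stieltjesDeriv l y d c (k + 1) t := by
  have h := kernelStieltjes_re_nonneg (l := l) (k + 1) (w := (y + t) / d) (by positivity)
  have hsq : ((-1 : ℝ) ^ k) * (-1) ^ k = 1 := by rw [← mul_pow]; simp
  have e : (-1 : ℝ) ^ k * stieltjesDeriv l y d c (k + 1) t =
      (if k = 0 then 1 else 0) + (k + 1).factorial * c / d ^ k *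
        (kernelStieltjes l (k + 1) ((y + t) / d : ℝ)).re := by
    simp only [stieltjesDeriv]
    have : (-1 : ℝ) ^ k * (if k = 0 then 1 else 0) = if k = 0 then 1 else 0 := by
      split_ifs with hk <;> simp [hk]
    rw [mul_add, this]
    linear_combination ((k + 1).factorial * c / d ^ k *
        (kernelStieltjes l (k + 1) ((y + t) / d : ℝ)).re) * hsq
  rw [e]
  split_ifs <;> positivity

theorem isBernsteinOn_weightedGeom_of_lt (hl0 : 0 < l) (hl1 : l < 1) {x y : ℝ} (hxy : y < x) :
    IsBernsteinOn (weightedGeom x y l) (Ioi (-y)) := by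
  have hd : 0 < x - y := by linarith
  have hc : 0 ≤ Real.sin (l * Real.pi) / Real.pi :=
    div_nonneg (Real.sin_nonneg_of_nonneg_of_le_pi (by positivity)
      (by nlinarith [Real.pi_pos])) Real.pi_pos.le
  have hpos : ∀ t ∈ Ioi (-y), 0 < y + t := fun t ht => by
    have : -y < t := ht
    linarith
  refine isBernsteinOn_of_hasDerivAt isOpen_Ioi
    (D := stieltjesDeriv l y (x - y) (Real.sin (l * Real.pi) / Real.pi))
    (fun t ht => weightedGeom_nonneg (by linarith [hpos t ht]) (hpos t ht))
    (contDiffOn_weightedGeom hxy.le) (fun t ht => ?_)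
    (fun k t ht => hasDerivAt_stieltjesDeriv hl0 hl1 _ hd k (hpos t ht))
    (fun k t ht => stieltjesDeriv_sign hd hc k (hpos t ht))
  have hz : (y : ℂ) + t ∈ Complex.slitPlane := Or.inl (by simpa using hpos t ht)
  have h := weightedGeomC_eq_stieltjes hl0 hl1 hxy hz
  rw [weightedGeomC_ofReal hxy ht, ← Complex.ofReal_add, ← Complex.ofReal_div,
    kernelStieltjes_ofReal] at h
  simp only [stieltjesDeriv]
  rw [kernelStieltjes_ofReal, Complex.ofReal_re]
  exact_mod_cast h

theorem isBernsteinOn_weightedGeom_self (y : ℝ) :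
    IsBernsteinOn (weightedGeom y y l) (Ioi (-y)) := by
  have hpos : ∀ t ∈ Ioi (-y), 0 < y + t := fun t ht => by
    have : -y < t := ht
    linarith
  refine isBernsteinOn_of_hasDerivAt isOpen_Ioi
    (D := fun k t => if k = 0 then y + t else if k = 1 then 1 else 0)
    (fun t ht => weightedGeom_nonneg (hpos t ht) (hpos t ht))
    (contDiffOn_weightedGeom le_rfl) (fun t ht => ?_) (fun k t ht => ?_) (fun k t ht => ?_)
  · simp only [weightedGeom, if_true]
    rw [← Real.rpow_add (hpos t ht), add_sub_cancel, Real.rpow_one]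
  · rcases k with _ | _ | k
    · simpa using (hasDerivAt_id t).const_add y
    · simpa using hasDerivAt_const t (1 : ℝ)
    · simpa using hasDerivAt_const t (0 : ℝ)
  · rcases k with _ | k <;> simp

theorem weightedGeom_swap (x y l : ℝ) : weightedGeom x y l = weightedGeom y x (1 - l) := by
  funext t
  rw [weightedGeom, weightedGeom, sub_sub_cancel, mul_comm]

theorem isBernsteinOn_weightedGeom (hl0 : 0 < l) (hl1 : l < 1) (x y : ℝ) :
    IsBernsteinOn (weightedGeom x y l) (Ioi (-(min x y))) := by
  rcases lt_trichotomy x y with h | rfl | h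
  · rw [min_eq_left h.le, weightedGeom_swap]
    exact isBernsteinOn_weightedGeom_of_lt (by linarith) (by linarith) h
  · rw [min_self]
    exact isBernsteinOn_weightedGeom_self x
  · rw [min_eq_right h.le]
    exact isBernsteinOn_weightedGeom_of_lt hl0 hl1 h

end Bernstein


theorem mainTheorem1 (l : ℝ) (hl0 : 0 < l) (hl1 : l < 1) :
    -- `F(l,s)` is a convergent integral and is positive
    (∀ s : ℝ, 0 < s →
      MeasureTheory.IntegrableOn (fun u : ℝ => kernelWeight l u * Real.exp (-(u * s)))
        (Set.Ioo (0 : ℝ) 1) ∧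
      0 < kernelF l s) ∧
    (∀ x y : ℝ, 0 < y → y < x →
      -- the principal branch: holomorphic on the slit plane, equal to the real mean on `(-y,∞)`
      DifferentiableOn ℂ (weightedGeomC x y l) (slitAt y) ∧
      (∀ t : ℝ, -y < t → weightedGeomC x y l (t : ℂ) = (weightedGeom x y l t : ℂ)) ∧
      -- the representation, where the integral over `(0,∞)` converges
      (∀ z ∈ slitAt y, -y ≤ z.re →
        MeasureTheory.IntegrableOn (meanIntegrand x y l z) (Set.Ioi 0) ∧
        weightedGeomC x y l z = ((x ^ l * y ^ (1 - l) : ℝ) : ℂ) + z +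
          ((Real.sin (l * Real.pi) / Real.pi * (x - y) : ℝ) : ℂ) *
            ∫ s in Set.Ioi (0 : ℝ), meanIntegrand x y l z s) ∧
      -- the representation on all of the slit plane, the integral from `0` to `∞` being taken
      -- along any ray of the right half-plane on which `e^{-s(y+z)}` does not grow
      (∀ z ∈ slitAt y, ∀ ω : ℂ, 0 < ω.re → 0 ≤ (ω * ((y : ℂ) + z)).re →
        MeasureTheory.IntegrableOn (alongRay (meanIntegrandC x y l z) ω) (Set.Ioi 0) ∧
        weightedGeomC x y l z = ((x ^ l * y ^ (1 - l) : ℝ) : ℂ) + z +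
          ((Real.sin (l * Real.pi) / Real.pi * (x - y) : ℝ) : ℂ) *
            ∫ r in Set.Ioi (0 : ℝ), alongRay (meanIntegrandC x y l z) ω r) ∧
      -- and such rays exist for every point of the slit plane
      (∀ z ∈ slitAt y, ∃ ω : ℂ, 0 < ω.re ∧ 0 < (ω * ((y : ℂ) + z)).re)) ∧
    -- the Bernstein property, for all positive `x`, `y`
    (∀ x y : ℝ, 0 < x → 0 < y →
      IsBernsteinOn (weightedGeom x y l) (Set.Ioi (-(min x y)))) := by
  refine ⟨fun s hs => ⟨integrableOn_kernelWeight_mul_real_exp hl0 hl1 s, kernelF_pos hl0 hl1 hs⟩,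
    fun x y hy hxy => ⟨differentiableOn_weightedGeomC hxy,
      fun t ht => weightedGeomC_ofReal hxy ht, fun z hz hre => ?_,
      fun z hz ω hω hωz => ⟨(integral_alongRay hl0 hl1 hy hxy hω hωz).1,
        weightedGeomC_eq_add_integral hl0 hl1 hy hxy hz hω hωz⟩,
      fun z hz => exists_ray (add_mem_slitPlane_of_mem_slitAt hz)⟩,
    fun x y _ _ => isBernsteinOn_weightedGeom hl0 hl1 x y⟩
  -- The positive half-line is the ray `ω = 1`, whose admissibility condition reads `Re z ≥ -y`.
  have h1 : (0 : ℝ) < (1 : ℂ).re := by simp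
  have hz' : 0 ≤ ((1 : ℂ) * ((y : ℂ) + z)).re := by
    simp only [one_mul, Complex.add_re, Complex.ofReal_re]
    linarith
  rw [meanIntegrand_eq_alongRay_one]
  exact ⟨(integral_alongRay hl0 hl1 hy hxy h1 hz').1,
    weightedGeomC_eq_add_integral hl0 hl1 hy hxy hz h1 hz'⟩
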